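/- Let $\mathcal T_3=\{0,1,2\}^*$ be the $3$-regular rooted tree, whose vertices are the finite words over $\{0,1,2\}=\mathbb Z/3\mathbb Z$. Let $a$ be the automorphism of $\mathcal T_3$ given by $a(xw)=(x+1)w$ for every letter $x$ and word $w$, and let $t$ be the automorphism defined recursively by $t=\langle\langle a,1,t\rangle\rangle$, that is, $t(0w)=0\,a(w)$, $t(1w)=1w$, $t(2w)=2\,t(w)$; both fix the root. The Fabrykowski–Gupta group is the subgroup $G=\langle a,t\rangle$ of $\mathrm{Aut}(\mathcal T_3)$. **Theorem.** The Fabrykowski–Gupta group $G$ is generated by two elements, contains no free subsemigroup on two generators, and is not a periodic extension of a locally nilpotent group: there is no exact sequence of groups $1\to N\to G\to P\to 1$ in which $N$ is locally nilpotent (every finitely generated subgroup of $N$ is nilpotent) and $P$ is periodic (every element of $P$ has finite order). Consequently the question of Longobardi, Maj and Rhemtulla has a negative answer: it is not true that every finitely generated group with no free subsemigroup on two generators is a periodic extension of a locally nilpotent group. -/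

import Mathlib

namespace FabrykowskiGupta

/-- The vertices of the `3`-regular rooted tree: finite words over `{0, 1, 2} = ℤ/3`, the root being
the empty word, and the words below `w` being those that have `w` as a prefix. -/
abbrev Vertex : Type := List (Fin 3)

/-- The automorphism group of the rooted tree: the permutations of the vertices that preserve the
prefix order in both directions. -/
def treeAut : Subgroup (Equiv.Perm Vertex) where
  carrier := {f | ∀ u v : Vertex, f u <+: f v ↔ u <+: v}
  mul_mem' := by
    intro f g hf hg u v
    rw [Equiv.Perm.mul_apply, Equiv.Perm.mul_apply, hf, hg]
  one_mem' := fun _ _ => Iff.rfl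
  inv_mem' := by
    intro f hf u v
    have h := hf (f⁻¹ u) (f⁻¹ v)
    simp only [Equiv.Perm.inv_def, Equiv.apply_symm_apply] at h
    exact h.symm

/-- Addition of `c` (modulo `3`) to the first letter. -/
def rotate (c : Fin 3) : Vertex → Vertex
  | [] => []
  | x :: w => (x + c) :: w

/-- The automorphism `a`, which permutes the three subtrees below the root cyclically. -/
def a : Equiv.Perm Vertex where
  toFun := rotate 1
  invFun := rotate 2
  left_inv := by
    rintro (_ | ⟨x, w⟩)
    · rfl
    · simp [rotate, add_assoc]
  right_inv := by
    rintro (_ | ⟨x, w⟩)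
    · rfl
    · simp [rotate, add_assoc]

/-- The map that fixes the first level, acts as `f` below the vertex `0`, trivially below the
vertex `1`, and as itself below the vertex `2`. -/
def directed (f : Vertex → Vertex) : Vertex → Vertex
  | [] => []
  | 0 :: w => 0 :: f w
  | 1 :: w => 1 :: w
  | 2 :: w => 2 :: directed f w

theorem directed_comp {f g : Vertex → Vertex} (h : ∀ w, f (g w) = w) (w : Vertex) :
    directed f (directed g w) = w := by
  induction w with
  | nil => rfl
  | cons x w ih => fin_cases x <;> simp [directed, h, ih]

/-- The automorphism `t`, given recursively by `t = ⟨⟨a, 1, t⟩⟩`. -/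
def t : Equiv.Perm Vertex where
  toFun := directed a
  invFun := directed a.symm
  left_inv := directed_comp a.symm_apply_apply
  right_inv := directed_comp a.apply_symm_apply

theorem a_mem_treeAut : a ∈ treeAut := by
  rintro (_ | ⟨x, u⟩) (_ | ⟨y, v⟩) <;> simp [a, rotate, List.cons_prefix_cons]

theorem t_mem_treeAut : t ∈ treeAut := by
  intro u
  induction u with
  | nil => intro v; simp [t, directed]
  | cons x u ih =>
    rintro (_ | ⟨y, v⟩)
    · fin_cases x <;> simp [t, directed]
    · have h1 := ih v
      have h2 := a_mem_treeAut u v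
      simp only [t, Equiv.coe_fn_mk] at h1
      fin_cases x <;> fin_cases y <;>
        simp [t, directed, List.cons_prefix_cons, h1, h2]

/-- The recursion `t = ⟨⟨a, 1, t⟩⟩`, spelled out on vertices. -/
theorem t_apply (w : Vertex) :
    t (0 :: w) = 0 :: a w ∧ t (1 :: w) = 1 :: w ∧ t (2 :: w) = 2 :: t w :=
  ⟨rfl, rfl, rfl⟩

end FabrykowskiGupta

/-- The Fabrykowski-Gupta group: the group of automorphisms of the rooted tree generated by
`a` and `t`. -/
def fabrykowskiGuptaGroup : Subgroup FabrykowskiGupta.treeAut :=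
  Subgroup.closure
    {⟨FabrykowskiGupta.a, FabrykowskiGupta.a_mem_treeAut⟩,
      ⟨FabrykowskiGupta.t, FabrykowskiGupta.t_mem_treeAut⟩}

/-- `G` contains a free semigroup on two generators. -/
def HasFreeSubsemigroup (G : Type*) [Group G] : Prop :=
  ∃ f : FreeSemigroup (Fin 2) →ₙ* G, Function.Injective f

/-- Every finitely generated subgroup of `G` is nilpotent. -/
def IsLocallyNilpotentGroup (G : Type*) [Group G] : Prop :=
  ∀ H : Subgroup G, H.FG → Group.IsNilpotent H

/-- There is an exact sequence `1 → N → G → P → 1` with `N` locally nilpotent and `P` periodic. -/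
def IsPeriodicExtensionOfLocallyNilpotent.{u} (G : Type u) [Group G] : Prop :=
  ∃ (N P : Type u) (_ : Group N) (_ : Group P) (_ : GroupExtension N G P),
    IsLocallyNilpotentGroup N ∧ IsMulTorsion P

/-!
The Fabrykowski-Gupta group is generated by `a` and `t` by definition. The other two properties come
from its self-similarity: an element `node σ s` is a permutation `σ` of the first level together
with three sections `s 0`, `s 1`, `s 2`, which are again elements of the group.

*No free subsemigroup.* A free subsemigroup forces exponential growth, so it is enough that the
group has subexponential growth (`exists_card_ball_le`). Let the length of an element be the number
of syllables `t ^ e` that it needs, powers of `a` being free of charge; `ball n` consists of the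
elements of length at most `n`. As `t = ⟨⟨a, 1, t⟩⟩`, the lengths of the three sections of an element
have sum at most its length, and the same holds for the nine sections at the second level. As
`lift F` collects the elements whose sections have `F`-degrees of bounded sum, this says
`ball n ⊆ lift (lift ball) n`.

Call an element of `ball L` irreducible if its nine lengths have sum at least `L`. It is given by a
word `t ^ e₁ * a ^ c₁ * t ^ e₂ * a ^ c₂ * ⋯` none of whose factors is shortened on the second level.
The factors that are shortened include those with a zero exponent, those with `(cᵢ, cᵢ₊₁) = (1, 2)`
and, in a stretch with constant `c`, those with `(eᵢ, eᵢ₊₃) = (1, 2)` (`IsReduced.rotation_step`,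
`IsReduced.exponent_step`). So, apart from a bounded number of letters, `c` is `2, …, 2, 1, …, 1`,
and so is `e` along each residue class modulo `3` in each of the two stretches. Hence there are only
polynomially many irreducible elements (`exists_card_irreducibles_le`).

Now cut a long element into `2 * k` blocks of length `L`. If `k` of them are reducible, the sum of
the lengths at the second level is smaller by `k`; otherwise `k` of them belong to a set of
polynomial size (`card_ball_le`). Let `r` be the exponential growth rate, and suppose that `r > 1`.
The elements of the first kind are too rare to account for the growth, and those of the second kind
give `r ^ (2 * L) ≤ 4 * |irreducibles L| * |ball L|`. The right hand side is `r ^ L` up to a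
subexponential factor, a contradiction for large `L`.

*No periodic extension.* Let `N` be a normal subgroup with periodic quotient. It contains
`u = (a * t) ^ k` for some `k > 0`. The section of `(a * t) ^ 3` at the vertex `1` is `a * t` again,
so after some levels `u` permutes three subtrees cyclically, and `u ^ 3` acts on the first of them
as a power `(a * t) ^ l`. The group branches over its derived subgroup (`graft_one_mem_derived`), so
it has an element `h` that acts as `(a * t) ^ 3` on that subtree and trivially elsewhere. The
conjugates of `h` under `u` are three commuting, independent elements of infinite order that `u`
permutes cyclically (`exists_isShifted`). The commutator of `h⁻¹` and `u` lies in `N`, and its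
iterated commutators with `u` never vanish, as in `ℤ ≀ C₃`. So it generates together with `u` a
subgroup of `N` that is not nilpotent (`IsShifted.not_isNilpotent`).
-/

namespace FabrykowskiGupta

open scoped Pointwise

/-! ### Tree permutations and their sections -/

/-- Permutations of the vertex set of the ternary tree. -/
abbrev TreePerm : Type := Equiv.Perm Vertex

/-- The tree permutation `⟨⟨s 0, s 1, s 2⟩⟩ σ`: it sends `x :: w` to `σ x :: s x w`. -/
def node (σ : Equiv.Perm (Fin 3)) (s : Fin 3 → TreePerm) : TreePerm where
  toFun
    | [] => []
    | x :: w => σ x :: s x w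
  invFun
    | [] => []
    | x :: w => σ.symm x :: (s (σ.symm x)).symm w
  left_inv := by rintro (_ | ⟨x, w⟩) <;> simp
  right_inv := by rintro (_ | ⟨x, w⟩) <;> simp

@[simp] theorem node_nil (σ : Equiv.Perm (Fin 3)) (s : Fin 3 → TreePerm) : node σ s [] = [] := rfl

@[simp] theorem node_cons (σ : Equiv.Perm (Fin 3)) (s : Fin 3 → TreePerm) (x : Fin 3)
    (w : Vertex) : node σ s (x :: w) = σ x :: s x w := rfl

theorem node_mul (σ τ : Equiv.Perm (Fin 3)) (s r : Fin 3 → TreePerm) :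
    node σ s * node τ r = node (σ * τ) (fun x => s (τ x) * r x) := by
  ext1 w
  rcases w with _ | ⟨x, w⟩ <;> simp

theorem node_one : node 1 1 = 1 := by
  ext1 w
  rcases w with _ | ⟨x, w⟩ <;> simp

/-- The `3`-cycle `x ↦ x + 1` through which `a` permutes the first level. -/
def shift : Equiv.Perm (Fin 3) := Equiv.addRight 1

@[simp] theorem shift_apply (x : Fin 3) : shift x = x + 1 := rfl

theorem a_eq_node : a = node shift 1 := by
  ext1 w
  rcases w with _ | ⟨x, w⟩ <;> simp [a, rotate]

theorem t_eq_node : t = node 1 ![a, 1, t] := by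
  ext1 w
  rcases w with _ | ⟨x, w⟩
  · rfl
  · fin_cases x
    · exact (t_apply w).1
    · exact (t_apply w).2.1
    · exact (t_apply w).2.2

theorem a_pow_eq_node (c : ℕ) : a ^ c = node (shift ^ c) 1 := by
  induction c with
  | zero => simp [node_one]
  | succ c ih => rw [pow_succ, ih, a_eq_node, node_mul, pow_succ]; congr 1

theorem t_pow_eq_node (e : ℕ) : t ^ e = node 1 ![a ^ e, 1, t ^ e] := by
  induction e with
  | zero =>
    rw [pow_zero, ← node_one]; congr 1; ext1 x; fin_cases x <;> simp [node_one]
  | succ e ih =>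
    rw [pow_succ]
    nth_rw 1 [ih]
    nth_rw 2 [t_eq_node]
    rw [node_mul]
    congr 1
    ext1 x
    fin_cases x <;> simp [pow_succ]

theorem a_pow_three : a ^ 3 = 1 := by
  rw [a_pow_eq_node, ← node_one]
  congr 1
  decide

theorem t_pow_three : t ^ 3 = 1 := by
  ext1 w
  induction w with
  | nil => rw [t_pow_eq_node]; rfl
  | cons x w ih =>
    rw [t_pow_eq_node, node_cons]
    fin_cases x
    · simp [a_pow_three]
    · simp
    · simpa using ih

/-! ### Balls for the length that counts the letters `t` -/

section Balls
open scoped Classical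

/-- The three powers of `a`. -/
noncomputable def powersA : Finset TreePerm := (Finset.range 3).image (a ^ ·)

/-- The three powers of `t`. -/
noncomputable def powersT : Finset TreePerm := (Finset.range 3).image (t ^ ·)

theorem mem_powersA {g : TreePerm} : g ∈ powersA ↔ ∃ c : ℕ, c < 3 ∧ a ^ c = g := by
  simp [powersA]

theorem mem_powersT {g : TreePerm} : g ∈ powersT ↔ ∃ e : ℕ, e < 3 ∧ t ^ e = g := by
  simp [powersT]

theorem a_pow_mem_powersA (c : ℕ) : a ^ c ∈ powersA :=
  mem_powersA.2 ⟨c % 3, Nat.mod_lt _ (by norm_num), by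
    conv_rhs => rw [← Nat.div_add_mod c 3, pow_add, pow_mul, a_pow_three, one_pow, one_mul]⟩

theorem t_pow_mem_powersT (e : ℕ) : t ^ e ∈ powersT := by
  refine mem_powersT.2 ⟨e % 3, Nat.mod_lt _ (by norm_num), ?_⟩
  conv_rhs => rw [← Nat.div_add_mod e 3, pow_add, pow_mul, t_pow_three, one_pow, one_mul]

/-- The products of powers of `a` and `t` with at most `n` syllables `t ^ e`. Powers of `a` are free
of charge. -/
noncomputable def ball (n : ℕ) : Finset TreePerm := powersA * (powersT * powersA) ^ n

/-- A family of finite sets that is multiplicative in the degree and contains the powers of `a` in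
degree `0` and those of `t` in degree `1`. The balls are the smallest such family. -/
structure IsFiltration (F : ℕ → Finset TreePerm) : Prop where
  a_pow_mem : ∀ c : ℕ, a ^ c ∈ F 0
  t_pow_mem : ∀ e : ℕ, t ^ e ∈ F 1
  mul_mem : ∀ {m n : ℕ} {g h : TreePerm}, g ∈ F m → h ∈ F n → g * h ∈ F (m + n)

theorem powersA_mul_powersA : powersA * powersA = powersA := by
  ext g
  rw [Finset.mem_mul]
  constructor
  · rintro ⟨x, hx, y, hy, rfl⟩
    obtain ⟨c, -, rfl⟩ := mem_powersA.1 hx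
    obtain ⟨d, -, rfl⟩ := mem_powersA.1 hy
    rw [← pow_add]
    exact a_pow_mem_powersA _
  · intro hg
    exact ⟨g, hg, 1, by simpa using a_pow_mem_powersA 0, mul_one g⟩

theorem ball_mul_ball (m n : ℕ) : ball m * ball n = ball (m + n) := by
  have h : ball m * powersA = ball m := by
    cases m with
    | zero => simp [ball, powersA_mul_powersA]
    | succ m => simp only [ball, pow_succ, mul_assoc, powersA_mul_powersA]
  rw [ball, ball, ← ball, ← mul_assoc, h, ball, mul_assoc, ← pow_add, ← ball]

theorem isFiltration_ball : IsFiltration ball where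
  a_pow_mem c := by simpa [ball] using a_pow_mem_powersA c
  t_pow_mem e := by
    rw [ball, pow_one]
    refine Finset.mem_mul.2 ⟨a ^ 0, a_pow_mem_powersA 0, t ^ e, ?_, by simp⟩
    exact Finset.mem_mul.2 ⟨t ^ e, t_pow_mem_powersT e, a ^ 0, a_pow_mem_powersA 0, by simp⟩
  mul_mem hg hh := by
    rw [← ball_mul_ball]
    exact Finset.mul_mem_mul hg hh

namespace IsFiltration

variable {F : ℕ → Finset TreePerm}

theorem one_mem (hF : IsFiltration F) (n : ℕ) : 1 ∈ F n := by
  induction n with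
  | zero => simpa using hF.a_pow_mem 0
  | succ n ih => simpa using hF.mul_mem ih (hF.t_pow_mem 0)

theorem mono (hF : IsFiltration F) {m n : ℕ} (h : m ≤ n) : F m ⊆ F n := fun g hg => by
  obtain ⟨k, rfl⟩ := Nat.exists_eq_add_of_le h
  simpa using hF.mul_mem hg (hF.one_mem k)

theorem ball_subset (hF : IsFiltration F) (n : ℕ) : ball n ⊆ F n := by
  have hA : powersA ⊆ F 0 := fun g hg => by
    obtain ⟨c, -, rfl⟩ := mem_powersA.1 hg
    exact hF.a_pow_mem c
  induction n with
  | zero => simpa [ball] using hA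
  | succ n ih =>
    intro g hg
    rw [ball, pow_succ, ← mul_assoc, ← ball, Finset.mem_mul] at hg
    obtain ⟨x, hx, y, hy, rfl⟩ := hg
    obtain ⟨z, hz, b, hb, rfl⟩ := Finset.mem_mul.1 hy
    obtain ⟨e, -, rfl⟩ := mem_powersT.1 hz
    exact hF.mul_mem (ih hx) (hF.mul_mem (hF.t_pow_mem e) (hA hb))

end IsFiltration

/-! ### Passing to the first level -/

/-- The elements whose sections at the three vertices of the first level have `F`-degrees of sum at
most `m`. -/
noncomputable def lift (F : ℕ → Finset TreePerm) (m : ℕ) : Finset TreePerm :=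
  (Finset.univ : Finset (Equiv.Perm (Fin 3) × (Fin 3 → Fin (m + 1)))).biUnion fun p =>
    if ∑ x, (p.2 x : ℕ) ≤ m then (Fintype.piFinset fun x => F (p.2 x)).image (node p.1) else ∅

theorem mem_lift {F : ℕ → Finset TreePerm} {m : ℕ} {g : TreePerm} :
    g ∈ lift F m ↔ ∃ (σ : Equiv.Perm (Fin 3)) (s : Fin 3 → TreePerm) (n : Fin 3 → ℕ),
      ∑ x, n x ≤ m ∧ (∀ x, s x ∈ F (n x)) ∧ node σ s = g := by
  simp only [lift, Finset.mem_biUnion, Finset.mem_univ, true_and, Prod.exists]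
  constructor
  · rintro ⟨σ, n, h⟩
    split_ifs at h with hn
    · obtain ⟨s, hs, rfl⟩ := Finset.mem_image.1 h
      exact ⟨σ, s, fun x => n x, hn, Fintype.mem_piFinset.1 hs, rfl⟩
    · simp at h
  · rintro ⟨σ, s, n, hn, hs, rfl⟩
    have hlt : ∀ x, n x < m + 1 := fun x =>
      Nat.lt_succ_of_le ((Finset.single_le_sum (fun _ _ => Nat.zero_le _)
        (Finset.mem_univ x)).trans hn)
    refine ⟨σ, fun x => ⟨n x, hlt x⟩, ?_⟩
    rw [if_pos hn]
    exact Finset.mem_image_of_mem _ (Fintype.mem_piFinset.2 hs)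

theorem IsFiltration.lift {F : ℕ → Finset TreePerm} (hF : IsFiltration F) :
    IsFiltration (lift F) where
  a_pow_mem c := mem_lift.2 ⟨shift ^ c, 1, 0, by simp, fun _ => hF.one_mem _,
    (a_pow_eq_node c).symm⟩
  t_pow_mem e := mem_lift.2 ⟨1, ![a ^ e, 1, t ^ e], ![0, 0, 1], by simp [Fin.sum_univ_three],
    by
      intro x
      fin_cases x
      · exact hF.a_pow_mem e
      · exact hF.one_mem _
      · exact hF.t_pow_mem e, (t_pow_eq_node e).symm⟩
  mul_mem {m n g h} hg hh := by
    obtain ⟨σ, s, k, hk, hs, rfl⟩ := mem_lift.1 hg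
    obtain ⟨τ, r, l, hl, hr, rfl⟩ := mem_lift.1 hh
    refine mem_lift.2 ⟨σ * τ, fun x => s (τ x) * r x, fun x => k (τ x) + l x, ?_, fun x =>
      hF.mul_mem (hs _) (hr _), (node_mul _ _ _ _).symm⟩
    rw [Finset.sum_add_distrib, Equiv.sum_comp τ k]
    exact add_le_add hk hl

/-- Six permutations of the first level and at most `(m + 1) ^ 3` triples of degrees. -/
theorem card_lift_le {F : ℕ → Finset TreePerm} {C ρ : ℝ} (hρ : 1 ≤ ρ)
    (h : ∀ n, ((F n).card : ℝ) ≤ C * ρ ^ n) (m : ℕ) :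
    ((lift F m).card : ℝ) ≤ 6 * (m + 1) ^ 3 * (C ^ 3 * ρ ^ m) := by
  have hC : 0 ≤ C := by simpa using (Nat.cast_nonneg _).trans (h 0)
  have h1 : ((lift F m).card : ℝ) ≤
      ∑ p : Equiv.Perm (Fin 3) × (Fin 3 → Fin (m + 1)), C ^ 3 * ρ ^ m := by
    refine (Nat.cast_le.2 Finset.card_biUnion_le).trans ?_
    rw [Nat.cast_sum]
    refine Finset.sum_le_sum fun p _ => ?_
    split_ifs with hp
    · refine (Nat.cast_le.2 Finset.card_image_le).trans ?_
      rw [Fintype.card_piFinset, Nat.cast_prod]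
      calc ∏ x, ((F (p.2 x)).card : ℝ) ≤ ∏ x, C * ρ ^ (p.2 x : ℕ) :=
            Finset.prod_le_prod (fun _ _ => Nat.cast_nonneg _) fun x _ => h _
        _ = C ^ 3 * ρ ^ (∑ x, (p.2 x : ℕ)) := by
            rw [Finset.prod_mul_distrib, Finset.prod_pow_eq_pow_sum]; simp
        _ ≤ C ^ 3 * ρ ^ m := by gcongr
    · simp only [Finset.card_empty, Nat.cast_zero]
      positivity
  refine h1.trans (le_of_eq ?_)
  rw [Finset.sum_const, Finset.card_univ, Fintype.card_prod, Fintype.card_perm, Fintype.card_fun]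
  simp only [Fintype.card_fin, nsmul_eq_mul, Nat.cast_mul, Nat.cast_pow, Nat.cast_add, Nat.cast_one]
  norm_num [Nat.factorial]

end Balls

/-! ### Words and their factors -/

section Words
open scoped Classical

/-- The product `w s * w (s + 1) * ⋯ * w (s + n - 1)`. -/
def segment (w : ℕ → TreePerm) (s : ℕ) : ℕ → TreePerm
  | 0 => 1
  | n + 1 => segment w s n * w (s + n)

theorem segment_add (w : ℕ → TreePerm) (s m n : ℕ) :
    segment w s (m + n) = segment w s m * segment w (s + m) n := by
  induction n with
  | zero => simp [segment]
  | succ n ih => rw [← add_assoc, segment, ih, segment, mul_assoc, add_assoc]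

theorem segment_congr {w v : ℕ → TreePerm} {s r n : ℕ} (h : ∀ i < n, w (s + i) = v (r + i)) :
    segment w s n = segment v r n := by
  induction n with
  | zero => rfl
  | succ n ih =>
    rw [segment, segment, ih fun i hi => h i (hi.trans n.lt_succ_self), h n n.lt_succ_self]

theorem segment_three_mul (w : ℕ → TreePerm) (s m : ℕ) :
    segment w s (3 * m) =
      segment (fun k => w (s + 3 * k) * w (s + 3 * k + 1) * w (s + 3 * k + 2)) 0 m := by
  induction m with
  | zero => rfl
  | succ m ih =>
    rw [mul_add, mul_one, segment_add, ih, segment]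
    simp [segment, mul_assoc, add_assoc]

theorem segment_mem {F : ℕ → Finset TreePerm} (hF : IsFiltration F) {w : ℕ → TreePerm}
    (hw : ∀ i, w i ∈ F 1) (s n : ℕ) : segment w s n ∈ F n := by
  induction n with
  | zero => exact hF.one_mem 0
  | succ n ih => exact hF.mul_mem ih (hw _)

/-- The word with syllables `t ^ e i * a ^ c i`. -/
def syllable (e c : ℕ → ℕ) (i : ℕ) : TreePerm := t ^ e i * a ^ c i

theorem syllable_mem {F : ℕ → Finset TreePerm} (hF : IsFiltration F) (e c : ℕ → ℕ) (i : ℕ) :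
    syllable e c i ∈ F 1 :=
  hF.mul_mem (hF.t_pow_mem _) (hF.a_pow_mem _)

theorem exists_word_of_mem_ball {n : ℕ} {g : TreePerm} (hg : g ∈ ball n) :
    ∃ (d : ℕ) (e c : ℕ → ℕ), (∀ i, e i < 3 ∧ c i < 3) ∧
      g = a ^ d * segment (syllable e c) 0 n := by
  induction n generalizing g with
  | zero =>
    rw [ball, pow_zero, mul_one] at hg
    obtain ⟨d, -, rfl⟩ := mem_powersA.1 hg
    exact ⟨d, 0, 0, by simp, by simp [segment]⟩
  | succ n ih =>
    rw [ball, pow_succ, ← mul_assoc, ← ball, Finset.mem_mul] at hg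
    obtain ⟨x, hx, y, hy, rfl⟩ := hg
    obtain ⟨_, hz, _, hb, rfl⟩ := Finset.mem_mul.1 hy
    obtain ⟨e', he', rfl⟩ := mem_powersT.1 hz
    obtain ⟨c', hc', rfl⟩ := mem_powersA.1 hb
    obtain ⟨d, e, c, hec, rfl⟩ := ih hx
    refine ⟨d, fun i => if i < n then e i else e', fun i => if i < n then c i else c', ?_, ?_⟩
    · intro i
      by_cases hi : i < n <;> simp [hi, hec, he', hc']
    · rw [segment, mul_assoc]
      congr 2
      · exact segment_congr fun i hi => by simp [syllable, hi]
      · simp [syllable]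

/-- No segment of the first `L` letters of `w` has `F`-degree smaller than its length. -/
def IsReduced (F : ℕ → Finset TreePerm) (w : ℕ → TreePerm) (L : ℕ) : Prop :=
  ∀ s n m : ℕ, s + n ≤ L → m < n → segment w s n ∉ F m

theorem isReduced_of_notMem {F : ℕ → Finset TreePerm} (hF : IsFiltration F) {w : ℕ → TreePerm}
    (hw : ∀ i, w i ∈ F 1) {d L : ℕ} (h : ∀ m < L, a ^ d * segment w 0 L ∉ F m) :
    IsReduced F w L := by
  intro s n m hsn hm hmem
  obtain ⟨r, rfl⟩ := Nat.exists_eq_add_of_le hsn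
  refine h (s + m + r) (by omega) ?_
  rw [segment_add, segment_add, zero_add]
  have := hF.mul_mem (hF.mul_mem (segment_mem hF hw 0 s) hmem) (segment_mem hF hw (s + n) r)
  simpa only [zero_add] using hF.mul_mem (hF.a_pow_mem d) this

/-! ### Words that are shortened on the second level -/

theorem mem_lift_of_sections {F : ℕ → Finset TreePerm} {g s₀ s₁ s₂ : TreePerm} {n₀ n₁ n₂ : ℕ}
    (h₀ : s₀ ∈ F n₀) (h₁ : s₁ ∈ F n₁) (h₂ : s₂ ∈ F n₂) (hnil : g [] = [])
    (hcons : ∀ w, g (0 :: w) = 0 :: s₀ w ∧ g (1 :: w) = 1 :: s₁ w ∧ g (2 :: w) = 2 :: s₂ w) :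
    g ∈ lift F (n₀ + n₁ + n₂) := by
  refine mem_lift.2 ⟨1, ![s₀, s₁, s₂], ![n₀, n₁, n₂], by simp [Fin.sum_univ_three], ?_, ?_⟩
  · intro x
    fin_cases x
    exacts [h₀, h₁, h₂]
  · ext1 w
    rcases w with _ | ⟨x, w⟩
    · exact hnil.symm
    · fin_cases x
      exacts [(hcons w).1.symm, (hcons w).2.1.symm, (hcons w).2.2.symm]

theorem t_pow_nil (e : ℕ) : (t ^ e) [] = [] := by rw [t_pow_eq_node]; rfl

theorem t_pow_zero_cons (e : ℕ) (w : Vertex) : (t ^ e) (0 :: w) = 0 :: (a ^ e) w := by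
  rw [t_pow_eq_node]; rfl

theorem t_pow_one_cons (e : ℕ) (w : Vertex) : (t ^ e) (1 :: w) = 1 :: w := by
  rw [t_pow_eq_node]; rfl

theorem t_pow_two_cons (e : ℕ) (w : Vertex) : (t ^ e) (2 :: w) = 2 :: (t ^ e) w := by
  conv_lhs => rw [t_pow_eq_node]
  rfl

theorem a_nil : a [] = [] := rfl

theorem a_cons (x : Fin 3) (w : Vertex) : a (x :: w) = (x + 1) :: w := rfl

/-- The sections are `a ^ e₁ * t ^ e₂ * a ^ e₃`, `a ^ e₂` and `t ^ (e₁ + e₃)`: the middle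
syllable is inert at the vertex `2`, and the outer two merge there. -/
theorem mem_lift_two {F : ℕ → Finset TreePerm} (hF : IsFiltration F) (e₁ e₂ e₃ : ℕ) :
    t ^ e₁ * a * t ^ e₂ * (a * a) * t ^ e₃ ∈ lift F 2 := by
  refine mem_lift_of_sections (n₀ := 1) (n₁ := 0) (n₂ := 1)
    (hF.mul_mem (hF.mul_mem (hF.a_pow_mem e₁) (hF.t_pow_mem e₂)) (hF.a_pow_mem e₃))
    (hF.a_pow_mem e₂) (hF.t_pow_mem (e₁ + e₃)) ?_ fun w => ?_
  · simp [t_pow_nil, a_nil]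
  · refine ⟨?_, ?_, ?_⟩ <;>
      simp [a_cons, t_pow_zero_cons, t_pow_one_cons, t_pow_two_cons, pow_add]

/-- At the vertex `2` this word has the section `t ^ e 0 * a * t ^ e 3 * a ^ 2 * t ^ e 6`. -/
theorem mem_lift_lift_six_one {F : ℕ → Finset TreePerm} (hF : IsFiltration F)
    (e : ℕ → ℕ) (h₁ : e 2 = 1) (h₂ : e 5 = 2) :
    t ^ e 0 * a * t ^ e 1 * a * t ^ e 2 * a * t ^ e 3 * a * t ^ e 4 * a *
      t ^ e 5 * a * t ^ e 6 ∈ lift (lift F) 6 := by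
  have hL := hF.lift
  have m₀ := hL.mul_mem (hL.mul_mem (hL.mul_mem (hL.mul_mem (hL.a_pow_mem (e 0))
    (hL.t_pow_mem (e 1))) (hL.a_pow_mem (e 3))) (hL.t_pow_mem (e 4))) (hL.a_pow_mem (e 6))
  have m₁ := hL.mul_mem (hL.mul_mem (hL.mul_mem (hL.a_pow_mem (e 1)) (hL.t_pow_mem (e 2)))
    (hL.a_pow_mem (e 4))) (hL.t_pow_mem (e 5))
  norm_num only at m₀ m₁
  have m₂ : t ^ e 0 * a ^ e 2 * t ^ e 3 * a ^ e 5 * t ^ e 6 ∈ lift F 2 := by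
    simpa [h₁, h₂, pow_two] using mem_lift_two hF (e 0) (e 3) (e 6)
  refine mem_lift_of_sections (F := lift F) (n₀ := 2) (n₁ := 2) (n₂ := 2) m₀ m₁ m₂ ?_ fun w => ?_
  · simp [t_pow_nil, a_nil]
  · refine ⟨?_, ?_, ?_⟩ <;>
      simp [a_cons, t_pow_zero_cons, t_pow_one_cons, t_pow_two_cons]

/-- At the vertex `2` this word has the section `t ^ e 0 * a * t ^ e 3 * a ^ 2 * t ^ e 6`. -/
theorem mem_lift_lift_six_two {F : ℕ → Finset TreePerm} (hF : IsFiltration F)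
    (e : ℕ → ℕ) (h₁ : e 1 = 1) (h₂ : e 4 = 2) :
    t ^ e 0 * (a * a) * t ^ e 1 * (a * a) * t ^ e 2 * (a * a) * t ^ e 3 * (a * a) * t ^ e 4 *
      (a * a) * t ^ e 5 * (a * a) * t ^ e 6 ∈ lift (lift F) 6 := by
  have hL := hF.lift
  have m₀ := hL.mul_mem (hL.mul_mem (hL.mul_mem (hL.mul_mem (hL.a_pow_mem (e 0))
    (hL.t_pow_mem (e 2))) (hL.a_pow_mem (e 3))) (hL.t_pow_mem (e 5))) (hL.a_pow_mem (e 6))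
  have m₁ := hL.mul_mem (hL.mul_mem (hL.mul_mem (hL.t_pow_mem (e 1)) (hL.a_pow_mem (e 2)))
    (hL.t_pow_mem (e 4))) (hL.a_pow_mem (e 5))
  norm_num only at m₀ m₁
  have m₂ : t ^ e 0 * a ^ e 1 * t ^ e 3 * a ^ e 4 * t ^ e 6 ∈ lift F 2 := by
    simpa [h₁, h₂, pow_two] using mem_lift_two hF (e 0) (e 3) (e 6)
  refine mem_lift_of_sections (F := lift F) (n₀ := 2) (n₁ := 2) (n₂ := 2) m₀ m₁ m₂ ?_ fun w => ?_
  · simp [t_pow_nil, a_nil]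
  · refine ⟨?_, ?_, ?_⟩ <;>
      simp [a_cons, t_pow_zero_cons, t_pow_one_cons, t_pow_two_cons]

theorem IsReduced.exponent_ne_zero {F : ℕ → Finset TreePerm} (hF : IsFiltration F)
    {e c : ℕ → ℕ} {L : ℕ} (h : IsReduced F (syllable e c) L) {i : ℕ} (hi : i < L) : e i ≠ 0 := by
  intro h0
  refine h i 1 0 hi one_pos ?_
  simpa [segment, syllable, h0] using hF.a_pow_mem (c i)

theorem IsReduced.rotation_ne_zero {F : ℕ → Finset TreePerm} (hF : IsFiltration F)
    {e c : ℕ → ℕ} {L : ℕ} (h : IsReduced F (syllable e c) L) {i : ℕ} (hi : i + 1 < L) :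
    c i ≠ 0 := by
  intro h0
  refine h i 2 1 hi one_lt_two ?_
  have := hF.mul_mem (hF.t_pow_mem (e i + e (i + 1))) (hF.a_pow_mem (c (i + 1)))
  simpa [segment, syllable, h0, pow_add, mul_assoc] using this

theorem IsReduced.rotation_step {F : ℕ → Finset TreePerm} (hF : IsFiltration F)
    {e c : ℕ → ℕ} {L : ℕ} (h : IsReduced (lift F) (syllable e c) L) {i : ℕ} (hi : i + 2 < L) :
    ¬ (c i = 1 ∧ c (i + 1) = 2) := by
  rintro ⟨h1, h2⟩
  refine h i 3 2 hi (by norm_num) ?_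
  have := hF.lift.mul_mem (mem_lift_two hF (e i) (e (i + 1)) (e (i + 2)))
    (hF.lift.a_pow_mem (c (i + 2)))
  simpa [segment, syllable, h1, h2, pow_two, mul_assoc] using this

/-- In a stretch with constant rotation, an exponent `1` is not followed by the exponent `2` three
syllables later. -/
theorem IsReduced.exponent_step {F : ℕ → Finset TreePerm} (hF : IsFiltration F)
    {e c : ℕ → ℕ} {L : ℕ} (h : IsReduced (lift (lift F)) (syllable e c) L) {s p r : ℕ}
    (hsp : s + p ≤ L) (hr : r = 1 ∨ r = 2) (hc : ∀ i < p, c (s + i) = r) {j : ℕ} (hj : 2 ≤ j)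
    (hjp : j + 5 < p) : ¬ (e (s + j) = 1 ∧ e (s + j + 3) = 2) := by
  have key : ∀ q, q + 6 < p →
      (segment (syllable e c) (s + q) 6) * t ^ (e (s + q + 6)) ∉ lift (lift F) 6 := by
    intro q hq hmem
    refine h (s + q) 7 6 (by omega) (by norm_num) ?_
    have := hF.lift.lift.mul_mem hmem (hF.lift.lift.a_pow_mem (c (s + q + 6)))
    rwa [mul_assoc] at this
  have hc' : ∀ q i, q + i < p → c (s + q + i) = r := fun q i hi => by
    rw [add_assoc]; exact hc _ hi
  rintro ⟨h1, h2⟩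
  rcases hr with rfl | rfl
  · obtain ⟨q, rfl⟩ := Nat.exists_eq_add_of_le' hj
    refine key q (by omega) ?_
    have := mem_lift_lift_six_one hF (fun i => e (s + q + i)) h1 h2
    have h0 := hc' q 0 (by omega)
    simpa [segment, syllable, hc' q 1 (by omega), hc' q 2 (by omega), hc' q 3 (by omega),
      hc' q 4 (by omega), hc' q 5 (by omega), show c (s + q) = 1 from h0, mul_assoc] using this
  · obtain ⟨q, rfl⟩ := Nat.exists_eq_add_of_le' (one_le_two.trans hj)
    refine key q (by omega) ?_
    have := mem_lift_lift_six_two hF (fun i => e (s + q + i)) h1 h2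
    have h0 := hc' q 0 (by omega)
    simpa [segment, syllable, hc' q 1 (by omega), hc' q 2 (by omega), hc' q 3 (by omega),
      hc' q 4 (by omega), hc' q 5 (by omega), show c (s + q) = 2 from h0, pow_two,
      mul_assoc] using this

end Words

/-! ### Counting irreducible elements -/

section Count
open scoped Classical

/-- The sequence `2, …, 2, 1, 1, …` that starts with `κ` twos. -/
def threshold (κ i : ℕ) : ℕ := if i < κ then 2 else 1

theorem exists_threshold {f : ℕ → ℕ} {n : ℕ} (hf : ∀ i < n, f i = 1 ∨ f i = 2)
    (hstep : ∀ i, i + 1 < n → ¬ (f i = 1 ∧ f (i + 1) = 2)) :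
    ∃ κ ≤ n, ∀ i < n, f i = threshold κ i := by
  induction n with
  | zero => exact ⟨0, le_rfl, by simp⟩
  | succ n ih =>
    obtain ⟨κ, hκ, h⟩ := ih (fun i hi => hf i (by omega)) fun i hi => hstep i (by omega)
    rcases hf n n.lt_succ_self with h1 | h2
    · refine ⟨κ, by omega, fun i hi => ?_⟩
      rcases Nat.lt_succ_iff_lt_or_eq.1 hi with hi | rfl
      · exact h i hi
      · rw [h1, threshold, if_neg (by omega)]
    · -- every earlier value is `2`, because the value before a `2` is a `2`
      have hκn : κ = n := by
        by_contra hne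
        obtain ⟨m, rfl⟩ : ∃ m, n = m + 1 := ⟨n - 1, by omega⟩
        refine hstep m (by omega) ⟨?_, h2⟩
        rw [h m (by omega), threshold, if_neg (by omega)]
      refine ⟨n + 1, le_rfl, fun i hi => ?_⟩
      rw [threshold, if_pos hi]
      rcases Nat.lt_succ_iff_lt_or_eq.1 hi with hi | rfl
      · rw [h i hi, threshold, if_pos (by omega)]
      · exact h2

/-- Three consecutive syllables of rotation `r`, the exponents in each of the three residue classes
being given by a threshold. -/
def triple (r : ℕ) (κ : Fin 3 → ℕ) (k : ℕ) : TreePerm :=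
  t ^ threshold (κ 0) k * a ^ r * (t ^ threshold (κ 1) k * a ^ r) *
    (t ^ threshold (κ 2) k * a ^ r)

/-- A set that contains the reduced words of length `p` and constant rotation `r`: apart from a
bounded number of letters at the ends, these are given by three thresholds. -/
noncomputable def constantRotation (r p : ℕ) : Finset TreePerm :=
  ball 2 * (Finset.univ : Finset (Fin 3 → Fin ((p - 8) / 3 + 1))).image
    (fun κ => segment (triple r fun x => κ x) 0 ((p - 8) / 3)) * ball 8

theorem card_constantRotation_le (r p : ℕ) :
    (constantRotation r p).card ≤ (ball 2).card * (ball 8).card * (p + 1) ^ 3 := by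
  have h : (Finset.univ.image fun κ : Fin 3 → Fin ((p - 8) / 3 + 1) =>
      segment (triple r fun x => κ x) 0 ((p - 8) / 3)).card ≤ (p + 1) ^ 3 := by
    refine Finset.card_image_le.trans ?_
    rw [Finset.card_univ, Fintype.card_fun, Fintype.card_fin, Fintype.card_fin]
    exact Nat.pow_le_pow_left (by omega) 3
  calc (constantRotation r p).card ≤ (ball 2).card * _ * (ball 8).card :=
        Finset.card_mul_le.trans (Nat.mul_le_mul_right _ Finset.card_mul_le)
    _ ≤ (ball 2).card * (p + 1) ^ 3 * (ball 8).card := by gcongr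
    _ = _ := by ring

theorem IsReduced.segment_mem_constantRotation {F : ℕ → Finset TreePerm} (hF : IsFiltration F)
    {e c : ℕ → ℕ} {L : ℕ} (he : ∀ i, e i < 3)
    (h : IsReduced (lift (lift F)) (syllable e c) L) {s p r : ℕ}
    (hsp : s + p ≤ L) (hr : r = 1 ∨ r = 2) (hc : ∀ i < p, c (s + i) = r) :
    segment (syllable e c) s p ∈ constantRotation r p := by
  have hw := syllable_mem isFiltration_ball e c
  obtain hp | hp := Nat.lt_or_ge p 11
  · have hm : (p - 8) / 3 = 0 := by omega
    have := isFiltration_ball.mono (show p ≤ 2 + 8 by omega)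
      (segment_mem isFiltration_ball hw s p)
    rw [← ball_mul_ball] at this
    simpa [constantRotation, hm, segment, Finset.image_const, Finset.singleton_one] using this
  · -- two letters at the beginning and at most eight at the end are set aside, because a window of
    -- seven letters is needed around each pair of exponents that is compared
    set m := (p - 8) / 3 with hm
    obtain ⟨q, hq⟩ : ∃ q, p = 2 + 3 * m + q := ⟨p - 2 - 3 * m, by omega⟩
    have hq8 : q ≤ 8 := by omega
    have key : ∀ x : Fin 3, ∃ κ ≤ m, ∀ k < m, e (s + 2 + x + 3 * k) = threshold κ k := by
      intro x
      have hx := x.isLt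
      refine exists_threshold (fun k hk => ?_) fun k hk hstep => ?_
      · have := h.exponent_ne_zero hF.lift.lift (i := s + 2 + x + 3 * k) (by omega)
        have := he (s + 2 + x + 3 * k)
        omega
      · refine h.exponent_step hF hsp hr hc (j := 2 + x + 3 * k) (by omega) (by omega) ?_
        rwa [show s + (2 + (x : ℕ) + 3 * k) = s + 2 + x + 3 * k by omega]
    choose κ hκ hκe using key
    rw [hq, segment_add, segment_add, segment_three_mul]
    refine Finset.mul_mem_mul (Finset.mul_mem_mul (segment_mem isFiltration_ball hw _ _) ?_)
      (isFiltration_ball.mono hq8 (segment_mem isFiltration_ball hw _ _))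
    rw [← hq, ← hm]
    refine Finset.mem_image.2 ⟨fun x => ⟨κ x, Nat.lt_succ_of_le (hκ x)⟩, Finset.mem_univ _, ?_⟩
    refine segment_congr fun k hk => ?_
    have hs : ∀ x : Fin 3,
        syllable e c (s + 2 + x + 3 * k) = t ^ threshold (κ x) k * a ^ r := fun x => by
      have hx := x.isLt
      rw [syllable, hκe x k hk, show s + 2 + (x : ℕ) + 3 * k = s + (2 + x + 3 * k) by omega,
        hc _ (by omega)]
    rw [zero_add, triple, ← hs 0, ← hs 1, ← hs 2]
    simp only [Fin.val_zero, Fin.val_one, Fin.val_two, add_zero]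
    rw [show s + 2 + 1 + 3 * k = s + 2 + 3 * k + 1 by omega,
      show s + 2 + 2 + 3 * k = s + 2 + 3 * k + 2 by omega]

/-- The elements of the ball of radius `L` whose sections at the second level have lengths of sum at
least `L`. -/
noncomputable def irreducibles (L : ℕ) : Finset TreePerm :=
  (ball L).filter fun g => ∀ m < L, g ∉ lift (lift ball) m

/-- The rotations of a reduced word are `2, …, 2, 1, …, 1`, up to the last one. -/
theorem irreducibles_subset (L : ℕ) :
    irreducibles (L + 1) ⊆ (Finset.range (L + 1)).biUnion fun κ =>
      powersA * constantRotation 2 κ * constantRotation 1 (L - κ) * ball 1 := by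
  intro g hg
  obtain ⟨hg, hirr⟩ := Finset.mem_filter.1 hg
  obtain ⟨d, e, c, hec, rfl⟩ := exists_word_of_mem_ball hg
  have hF := isFiltration_ball
  have hred := isReduced_of_notMem hF.lift.lift (syllable_mem hF.lift.lift e c) hirr
  obtain ⟨κ, hκ, hc⟩ := exists_threshold (f := c) (n := L)
    (fun i hi => by
      have := hred.rotation_ne_zero hF.lift.lift (i := i) (by omega)
      have := (hec i).2
      omega)
    (fun i hi => hred.rotation_step hF.lift (by omega))
  refine Finset.mem_biUnion.2 ⟨κ, by simpa [Nat.lt_succ_iff] using hκ, ?_⟩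
  have hL : L + 1 = κ + (L - κ) + 1 := by omega
  rw [hL, segment_add, segment_add, ← mul_assoc, ← mul_assoc]
  refine Finset.mul_mem_mul (Finset.mul_mem_mul (Finset.mul_mem_mul (a_pow_mem_powersA d) ?_) ?_)
    (segment_mem hF (syllable_mem hF e c) _ _)
  · refine hred.segment_mem_constantRotation hF (fun i => (hec i).1) (by omega) (Or.inr rfl)
      fun i hi => ?_
    rw [zero_add, hc i (by omega), threshold, if_pos hi]
  · refine hred.segment_mem_constantRotation hF (fun i => (hec i).1) (by omega) (Or.inl rfl)
      fun i hi => ?_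
    rw [zero_add, hc _ (by omega), threshold, if_neg (by omega)]

theorem exists_card_irreducibles_le :
    ∃ K : ℕ, ∀ L, (irreducibles (L + 1)).card ≤ K * (L + 1) ^ 7 := by
  set B := (ball 2).card * (ball 8).card
  refine ⟨powersA.card * B * B * (ball 1).card, fun L => ?_⟩
  refine (Finset.card_le_card (irreducibles_subset L)).trans (Finset.card_biUnion_le.trans ?_)
  have h : ∀ κ ∈ Finset.range (L + 1),
      (powersA * constantRotation 2 κ * constantRotation 1 (L - κ) * ball 1).card ≤
        powersA.card * (B * (L + 1) ^ 3) * (B * (L + 1) ^ 3) * (ball 1).card := by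
    intro κ hκ
    have hκ := Finset.mem_range.1 hκ
    have h1 : (constantRotation 2 κ).card ≤ B * (L + 1) ^ 3 :=
      (card_constantRotation_le 2 κ).trans (by gcongr; omega)
    have h2 : (constantRotation 1 (L - κ)).card ≤ B * (L + 1) ^ 3 :=
      (card_constantRotation_le 1 _).trans (by gcongr; omega)
    refine Finset.card_mul_le.trans (Nat.mul_le_mul_right _ ?_)
    refine Finset.card_mul_le.trans (Nat.mul_le_mul ?_ h2)
    exact Finset.card_mul_le.trans (Nat.mul_le_mul_left _ h1)
  refine (Finset.sum_le_card_nsmul _ _ _ h).trans (le_of_eq ?_)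
  rw [Finset.card_range, smul_eq_mul]
  ring

end Count

/-! ### Exponential comparison -/

theorem le_of_forall_pow_le {x y C : ℝ} (hy : 0 < y) (h : ∀ n : ℕ, x ^ n ≤ C * y ^ n) :
    x ≤ y := by
  by_contra! hlt
  obtain ⟨n, hn⟩ := pow_unbounded_of_one_lt C ((one_lt_div hy).2 hlt)
  rw [div_pow, lt_div_iff₀ (pow_pos hy n)] at hn
  exact (h n).not_gt hn

theorem exists_polynomial_mul_pow_le (d : ℕ) {r s : ℝ} (hr : 0 < r) (hrs : r < s) :
    ∃ B : ℝ, ∀ n : ℕ, ((n : ℝ) + 1) ^ d * r ^ n ≤ B * s ^ n := by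
  have hs := hr.trans hrs
  have hq : |r / s| < 1 := by
    rw [abs_of_pos (div_pos hr hs)]
    exact (div_lt_one hs).2 hrs
  obtain ⟨B, hB⟩ := (tendsto_pow_const_mul_const_pow_of_abs_lt_one d hq).bddAbove_range
  refine ⟨B * (s / r), fun n => ?_⟩
  have h := hB ⟨n + 1, rfl⟩
  simp only [Nat.cast_add, Nat.cast_one] at h
  rw [div_pow, ← mul_div_assoc, div_le_iff₀ (pow_pos hs _), pow_succ, pow_succ s, ← mul_assoc,
    ← mul_assoc] at h
  rw [mul_assoc, div_mul_eq_mul_div, ← mul_div_assoc, le_div_iff₀ hr]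
  linarith

/-- A submultiplicative sequence has an exponential growth rate `r`, by Fekete's lemma, and `r ^ n`
bounds it from below. -/
theorem exists_growth_rate {f : ℕ → ℝ} (hf : ∀ n, 1 ≤ f n) (hmul : ∀ m n, f (m + n) ≤ f m * f n) :
    ∃ r : ℝ, 1 ≤ r ∧ (∀ n, r ^ n ≤ f n) ∧ ∀ s, r < s → ∃ C, ∀ n, f n ≤ C * s ^ n := by
  have hpos : ∀ n, 0 < f n := fun n => one_pos.trans_le (hf n)
  have hsub : Subadditive fun n => Real.log (f n) := fun m n => by
    rw [← Real.log_mul (hpos m).ne' (hpos n).ne']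
    exact Real.log_le_log (hpos _) (hmul m n)
  have hbdd : BddBelow (Set.range fun n : ℕ => Real.log (f n) / n) := by
    refine ⟨0, ?_⟩
    rintro _ ⟨n, rfl⟩
    exact div_nonneg (Real.log_nonneg (hf n)) n.cast_nonneg
  have hlim : 0 ≤ hsub.lim := ge_of_tendsto' (hsub.tendsto_lim hbdd) fun n =>
    div_nonneg (Real.log_nonneg (hf n)) n.cast_nonneg
  refine ⟨Real.exp hsub.lim, Real.one_le_exp hlim, fun n => ?_, fun s hs => ?_⟩
  · rcases Nat.eq_zero_or_pos n with rfl | hn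
    · simpa using hf 0
    · rw [← Real.exp_nat_mul, ← Real.le_log_iff_exp_le (hpos n), mul_comm]
      exact (le_div_iff₀ (by exact_mod_cast hn)).1 (hsub.lim_le_div hbdd hn.ne')
  · have hs1 : 1 ≤ s := (Real.one_le_exp hlim).trans hs.le
    have hlog : hsub.lim < Real.log s := (Real.lt_log_iff_exp_lt (by linarith)).2 hs
    obtain ⟨N, hN⟩ := Filter.eventually_atTop.1
      ((hsub.tendsto_lim hbdd).eventually (gt_mem_nhds hlog))
    have hsum : 0 ≤ ∑ i ∈ Finset.range (N + 1), f i := Finset.sum_nonneg fun i _ => (hpos i).le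
    refine ⟨1 + ∑ i ∈ Finset.range (N + 1), f i, fun n => ?_⟩
    have hsn : 1 ≤ s ^ n := one_le_pow₀ hs1
    rcases Nat.lt_or_ge N n with hn | hn
    · have hn0 : (0 : ℝ) < n := by exact_mod_cast (Nat.zero_le N).trans_lt hn
      have h1 : Real.log (f n) ≤ Real.log (s ^ n) := by
        rw [Real.log_pow, mul_comm]
        exact ((div_lt_iff₀ hn0).1 (hN n hn.le)).le
      have h2 := (Real.log_le_log_iff (hpos n) (by linarith)).1 h1
      nlinarith
    · have h1 : f n ≤ ∑ i ∈ Finset.range (N + 1), f i :=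
        Finset.single_le_sum (fun i _ => (hpos i).le) (Finset.mem_range.2 (by omega))
      nlinarith

/-! ### Products of blocks -/

section Blocks
open scoped Classical

/-- The elements of the ball of radius `L` that are not irreducible. -/
noncomputable def reducibles (L : ℕ) : Finset TreePerm := ball L \ irreducibles L

/-- Products of blocks from the ball of radius `L`, where the pattern says which of the blocks are
irreducible. -/
noncomputable def blockProducts (L : ℕ) : List Bool → Finset TreePerm
  | [] => powersA
  | true :: β => irreducibles L * blockProducts L β
  | false :: β => reducibles L * blockProducts L β

theorem exists_mem_blockProducts (L n : ℕ) {g : TreePerm} (hg : g ∈ ball (L * n)) :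
    ∃ β : Fin n → Bool, g ∈ blockProducts L (List.ofFn β) := by
  induction n generalizing g with
  | zero => exact ⟨Fin.elim0, by simpa [ball, blockProducts] using hg⟩
  | succ n ih =>
    rw [mul_add, mul_one, add_comm, ← ball_mul_ball] at hg
    obtain ⟨x, hx, y, hy, rfl⟩ := Finset.mem_mul.1 hg
    obtain ⟨β, hβ⟩ := ih hy
    by_cases hirr : x ∈ irreducibles L
    · refine ⟨Fin.cons true β, ?_⟩
      simpa [List.ofFn_succ, blockProducts] using Finset.mul_mem_mul hirr hβ
    · have hred : x ∈ reducibles L := Finset.mem_sdiff.2 ⟨hx, hirr⟩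
      refine ⟨Fin.cons false β, ?_⟩
      simpa [List.ofFn_succ, blockProducts] using Finset.mul_mem_mul hred hβ

theorem blockProducts_subset (L : ℕ) (β : List Bool) :
    blockProducts (L + 1) β ⊆ lift (lift ball) (L * β.count false + (L + 1) * β.count true) := by
  have hF := isFiltration_ball.lift.lift
  induction β with
  | nil => simpa [blockProducts, ball] using hF.ball_subset 0
  | cons b β ih =>
    intro g hg
    cases b with
    | true =>
      obtain ⟨x, hx, y, hy, rfl⟩ := Finset.mem_mul.1 hg
      have := hF.mul_mem (hF.ball_subset _ (Finset.mem_filter.1 hx).1) (ih hy)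
      refine hF.mono (le_of_eq ?_) this
      simp
      ring
    | false =>
      obtain ⟨x, hx, y, hy, rfl⟩ := Finset.mem_mul.1 hg
      obtain ⟨hx, hirr⟩ := Finset.mem_sdiff.1 hx
      obtain ⟨m, hm, hxm⟩ : ∃ m < L + 1, x ∈ lift (lift ball) m := by
        by_contra! hcon
        exact hirr (Finset.mem_filter.2 ⟨hx, hcon⟩)
      refine hF.mono ?_ (hF.mul_mem (hF.mono (Nat.lt_succ_iff.1 hm) hxm) (ih hy))
      simp
      linarith

theorem card_blockProducts_le (L : ℕ) (β : List Bool) :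
    (blockProducts L β).card ≤ powersA.card *
      ((irreducibles L).card ^ β.count true * (ball L).card ^ β.count false) := by
  induction β with
  | nil => simp [blockProducts]
  | cons b β ih =>
    cases b with
    | true =>
      refine (Finset.card_mul_le.trans (Nat.mul_le_mul_left _ ih)).trans (le_of_eq ?_)
      simp [pow_succ]
      ring
    | false =>
      have h := Finset.card_le_card (Finset.sdiff_subset (s := ball L) (t := irreducibles L))
      refine (Finset.card_mul_le.trans (Nat.mul_le_mul h ih)).trans (le_of_eq ?_)
      simp [pow_succ]
      ring

/-- Either at least half of the `2 * k` blocks are reducible, and the whole product is shorter on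
the second level, or at least half of them are irreducible. -/
theorem card_ball_le (L k : ℕ) :
    (ball ((L + 1) * (2 * k))).card ≤ (lift (lift ball) ((2 * L + 1) * k)).card +
      powersA.card * (4 * ((irreducibles (L + 1)).card * (ball (L + 1)).card)) ^ k := by
  set P := (irreducibles (L + 1)).card with hP
  set Γ := (ball (L + 1)).card with hΓ
  have hPΓ : P ≤ Γ := Finset.card_le_card (Finset.filter_subset _ _)
  set S : Finset (Fin (2 * k) → Bool) :=
    Finset.univ.filter fun β => k ≤ (List.ofFn β).count true with hS
  have hcount : ∀ β : Fin (2 * k) → Bool,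
      (List.ofFn β).count true + (List.ofFn β).count false = 2 * k := fun β => by
    rw [List.count_true_add_count_false, List.length_ofFn]
  have hsub : ball ((L + 1) * (2 * k)) ⊆ lift (lift ball) ((2 * L + 1) * k) ∪
      S.biUnion fun β => blockProducts (L + 1) (List.ofFn β) := by
    intro g hg
    obtain ⟨β, hβ⟩ := exists_mem_blockProducts _ _ hg
    by_cases hk : k ≤ (List.ofFn β).count true
    · exact Finset.mem_union_right _ (Finset.mem_biUnion.2 ⟨β, by simp [hS, hk], hβ⟩)
    · refine Finset.mem_union_left _ (isFiltration_ball.lift.lift.mono ?_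
        (blockProducts_subset L _ hβ))
      have := hcount β
      nlinarith
  refine (Finset.card_le_card hsub).trans ((Finset.card_union_le _ _).trans
    (Nat.add_le_add_left (Finset.card_biUnion_le.trans ?_) _))
  have hterm : ∀ β ∈ S, (blockProducts (L + 1) (List.ofFn β)).card ≤
      powersA.card * (P * Γ) ^ k := by
    intro β hβ
    have hk : k ≤ (List.ofFn β).count true := (Finset.mem_filter.1 hβ).2
    have := hcount β
    refine (card_blockProducts_le _ _).trans (Nat.mul_le_mul_left _ ?_)
    obtain ⟨j, hj⟩ := Nat.exists_eq_add_of_le hk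
    have hfalse : j + (List.ofFn β).count false = k := by omega
    rw [hj, ← hP, ← hΓ, pow_add, mul_assoc, mul_pow]
    refine Nat.mul_le_mul_left _ ?_
    calc P ^ j * Γ ^ (List.ofFn β).count false ≤ Γ ^ j * Γ ^ (List.ofFn β).count false := by gcongr
      _ = Γ ^ k := by rw [← pow_add, hfalse]
  refine (Finset.sum_le_card_nsmul _ _ _ hterm).trans ?_
  have hcard : S.card ≤ 4 ^ k := by
    refine (Finset.card_filter_le _ _).trans (le_of_eq ?_)
    rw [Finset.card_univ, Fintype.card_fun, Fintype.card_bool, Fintype.card_fin, pow_mul]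
    norm_num
  rw [smul_eq_mul, mul_pow 4]
  calc S.card * (powersA.card * (P * Γ) ^ k) ≤ 4 ^ k * (powersA.card * (P * Γ) ^ k) := by gcongr
    _ = _ := by ring

/-! ### Subexponential growth -/

theorem exists_card_lift_le {F : ℕ → Finset TreePerm} {r : ℝ} (hr : 1 ≤ r)
    (h : ∀ s, r < s → ∃ C, ∀ n, ((F n).card : ℝ) ≤ C * s ^ n) {s : ℝ} (hs : r < s) :
    ∃ C, ∀ n, ((lift F n).card : ℝ) ≤ C * s ^ n := by
  obtain ⟨q, hrq, hqs⟩ := exists_between hs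
  obtain ⟨C, hC⟩ := h q hrq
  obtain ⟨B, hB⟩ := exists_polynomial_mul_pow_le 3 (by linarith) hqs
  have hC0 : 0 ≤ C := by simpa using (Nat.cast_nonneg _).trans (hC 0)
  refine ⟨6 * C ^ 3 * B, fun n => (card_lift_le (hr.trans hrq.le) hC n).trans ?_⟩
  calc 6 * ((n : ℝ) + 1) ^ 3 * (C ^ 3 * q ^ n) = 6 * C ^ 3 * (((n : ℝ) + 1) ^ 3 * q ^ n) := by ring
    _ ≤ 6 * C ^ 3 * (B * s ^ n) := mul_le_mul_of_nonneg_left (hB n) (by positivity)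
    _ = _ := by ring

theorem one_le_card_ball (n : ℕ) : (1 : ℝ) ≤ (ball n).card := by
  exact_mod_cast Finset.card_pos.2 ⟨1, isFiltration_ball.one_mem n⟩

/-- The Fabrykowski-Gupta group has subexponential growth. -/
theorem exists_card_ball_le {s : ℝ} (hs : 1 < s) : ∃ C, ∀ n, ((ball n).card : ℝ) ≤ C * s ^ n := by
  obtain ⟨r, hr1, hlow, hup⟩ := exists_growth_rate one_le_card_ball fun m n => by
    rw [← ball_mul_ball]
    exact_mod_cast Finset.card_mul_le
  suffices hr : r = 1 by exact hup s (hr ▸ hs)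
  by_contra hne
  have hr : 1 < r := lt_of_le_of_ne hr1 (Ne.symm hne)
  have hup2 : ∀ s, r < s → ∃ C, ∀ n, ((lift (lift ball) n).card : ℝ) ≤ C * s ^ n := fun s hs =>
    exists_card_lift_le hr1 (fun s hs => exists_card_lift_le hr1 hup hs) hs
  -- irreducible blocks have to account for half of the growth
  have key : ∀ L : ℕ, r ^ (2 * (L + 1)) ≤
      4 * ((irreducibles (L + 1)).card * (ball (L + 1)).card) := by
    intro L
    have hlt : r ^ (2 * L + 1) < r ^ (2 * (L + 1)) := pow_lt_pow_right₀ hr (by omega)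
    obtain ⟨q, hq, hrq⟩ := (((((continuous_pow (2 * L + 1)).tendsto r).eventually
      (gt_mem_nhds hlt)).filter_mono nhdsWithin_le_nhds).and
      (self_mem_nhdsWithin (s := Set.Ioi r))).exists
    have hrq : r < q := hrq
    obtain ⟨C, hC⟩ := hup2 q hrq
    have hC0 : 0 ≤ C := by simpa using (Nat.cast_nonneg _).trans (hC 0)
    set Z : ℝ := 4 * ((irreducibles (L + 1)).card * (ball (L + 1)).card) with hZ
    have hq0 : 0 < q ^ (2 * L + 1) := pow_pos (by linarith) _
    have hmax : r ^ (2 * (L + 1)) ≤ max (q ^ (2 * L + 1)) Z := by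
      refine le_of_forall_pow_le (C := C + powersA.card) (lt_max_of_lt_left hq0) fun k => ?_
      have h1 : ((ball ((L + 1) * (2 * k))).card : ℝ) ≤
          (lift (lift ball) ((2 * L + 1) * k)).card + powersA.card * Z ^ k := by
        rw [hZ]
        exact_mod_cast card_ball_le L k
      calc (r ^ (2 * (L + 1))) ^ k = r ^ ((L + 1) * (2 * k)) := by rw [← pow_mul]; ring_nf
        _ ≤ C * q ^ ((2 * L + 1) * k) + powersA.card * Z ^ k :=
          (hlow _).trans (h1.trans (add_le_add_left (hC _) _))
        _ ≤ C * max (q ^ (2 * L + 1)) Z ^ k + powersA.card * max (q ^ (2 * L + 1)) Z ^ k := by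
          rw [pow_mul]
          gcongr
          · exact le_max_left _ _
          · exact le_max_right _ _
        _ = _ := by ring
    exact (le_max_iff.1 hmax).resolve_left (not_le.2 hq)
  -- and there are too few of them
  obtain ⟨K, hK⟩ := exists_card_irreducibles_le
  have hrr : r < r ^ 2 := by nlinarith
  obtain ⟨p, hrp, hp⟩ := exists_between hrr
  obtain ⟨q, hpq, hq⟩ := exists_between hp
  obtain ⟨C, hC⟩ := hup p hrp
  obtain ⟨B, hB⟩ := exists_polynomial_mul_pow_le 7 (by linarith) hpq
  have hC0 : 0 ≤ C := by simpa using (Nat.cast_nonneg _).trans (hC 0)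
  have hp0 : 0 < p := by linarith
  refine hq.not_ge (le_of_forall_pow_le (C := 4 * K * C * p * B) (by linarith) fun L => ?_)
  have hK' : ((irreducibles (L + 1)).card : ℝ) ≤ K * ((L : ℝ) + 1) ^ 7 := by exact_mod_cast hK L
  calc (r ^ 2) ^ L ≤ r ^ (2 * (L + 1)) := by
        rw [← pow_mul]; exact pow_le_pow_right₀ hr1 (by omega)
    _ ≤ 4 * ((irreducibles (L + 1)).card * (ball (L + 1)).card) := key L
    _ ≤ 4 * (K * ((L : ℝ) + 1) ^ 7 * (C * p ^ (L + 1))) := by gcongr; exact hC _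
    _ = 4 * K * C * p * (((L : ℝ) + 1) ^ 7 * p ^ L) := by ring
    _ ≤ 4 * K * C * p * (B * q ^ L) :=
      mul_le_mul_of_nonneg_left (hB L) (by positivity)
    _ = _ := by ring

end Blocks

/-! ### Absence of free subsemigroups -/

/-- The group generated by `a` and `t`, as a group of permutations of the vertices. -/
def gens : Subgroup TreePerm := Subgroup.closure {a, t}

theorem a_mem_gens : a ∈ gens := Subgroup.subset_closure (by simp)

theorem t_mem_gens : t ∈ gens := Subgroup.subset_closure (by simp)

/-- The inclusion of the Fabrykowski-Gupta group into the permutations of the vertices. -/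
def toTreePerm : fabrykowskiGuptaGroup →* TreePerm :=
  treeAut.subtype.comp fabrykowskiGuptaGroup.subtype

theorem toTreePerm_injective : Function.Injective toTreePerm :=
  Subtype.val_injective.comp Subtype.val_injective

theorem range_toTreePerm : toTreePerm.range = gens := by
  rw [toTreePerm, MonoidHom.range_comp, Subgroup.range_subtype, fabrykowskiGuptaGroup,
    MonoidHom.map_closure, gens, Set.image_pair]
  rfl

theorem exists_mem_ball {g : TreePerm} (hg : g ∈ gens) : ∃ n, g ∈ ball n := by
  have hF := isFiltration_ball
  -- the ball that contains the inverse is carried along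
  suffices ∃ n, g ∈ ball n ∧ g⁻¹ ∈ ball n from this.imp fun n h => h.1
  induction hg using Subgroup.closure_induction with
  | mem x hx =>
    rcases hx with rfl | rfl
    · refine ⟨0, by simpa using hF.a_pow_mem 1, ?_⟩
      rw [inv_eq_of_mul_eq_one_left (b := a) (a := a ^ 2) (by rw [← pow_succ, a_pow_three])]
      exact hF.a_pow_mem 2
    · refine ⟨1, by simpa using hF.t_pow_mem 1, ?_⟩
      rw [inv_eq_of_mul_eq_one_left (b := t) (a := t ^ 2) (by rw [← pow_succ, t_pow_three])]
      exact hF.t_pow_mem 2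
  | one => exact ⟨0, hF.one_mem 0, by simpa using hF.one_mem 0⟩
  | mul x y _ _ hx hy =>
    obtain ⟨m, hm, hm'⟩ := hx
    obtain ⟨n, hn, hn'⟩ := hy
    exact ⟨m + n, hF.mul_mem hm hn, by rw [mul_inv_rev, add_comm]; exact hF.mul_mem hn' hm'⟩
  | inv x _ hx =>
    obtain ⟨m, hm, hm'⟩ := hx
    exact ⟨m, hm', by rwa [inv_inv]⟩

/-- A free subsemigroup would contain `2 ^ n` elements of length linear in `n`. -/
theorem not_hasFreeSubsemigroup : ¬ HasFreeSubsemigroup fabrykowskiGuptaGroup := by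
  classical
  rintro ⟨f, hf⟩
  have hmem : ∀ g, ∃ n, toTreePerm g ∈ ball n := fun g =>
    exists_mem_ball (range_toTreePerm ▸ ⟨g, rfl⟩)
  choose N hN using fun i => hmem (f (FreeSemigroup.of i))
  set L := N 0 + N 1 with hL
  have hgen : ∀ i, toTreePerm (f (FreeSemigroup.of i)) ∈ ball L := fun i => by
    refine isFiltration_ball.mono ?_ (hN i)
    fin_cases i <;> simp [hL]
  have hword : ∀ (l : List (Fin 2)) (i : Fin 2),
      toTreePerm (f ⟨i, l⟩) ∈ ball (L * (l.length + 1)) := by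
    intro l
    induction l with
    | nil => intro i; simpa using! hgen i
    | cons j l ih =>
      intro i
      have h1 : (⟨i, j :: l⟩ : FreeSemigroup (Fin 2)) = FreeSemigroup.of i * ⟨j, l⟩ := rfl
      rw [h1, map_mul, map_mul, List.length_cons, mul_add L, mul_one, add_comm]
      exact isFiltration_ball.mul_mem (hgen i) (ih j)
  have hcard : ∀ n, 2 ^ n ≤ (ball (L * (n + 1))).card := by
    intro n
    have hinj : Function.Injective fun v : Fin n → Fin 2 =>
        toTreePerm (f ⟨0, List.ofFn v⟩) := by
      intro v w h
      have := hf (toTreePerm_injective h)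
      rw [FreeSemigroup.mk.injEq] at this
      exact List.ofFn_injective this.2
    have := Finset.card_le_card_of_injOn (s := Finset.univ) (t := ball (L * (n + 1)))
      (fun v : Fin n → Fin 2 => toTreePerm (f ⟨0, List.ofFn v⟩))
      (fun v _ => by simpa using hword (List.ofFn v) 0) hinj.injOn
    simpa using this
  obtain ⟨q, hq, hq1⟩ := ((((continuous_pow L).tendsto (1 : ℝ)).eventually
    (gt_mem_nhds (show (1 : ℝ) ^ L < 2 by norm_num))).filter_mono nhdsWithin_le_nhds).and
      (self_mem_nhdsWithin (s := Set.Ioi (1 : ℝ))) |>.exists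
  have hq1 : 1 < q := hq1
  obtain ⟨C, hC⟩ := exists_card_ball_le hq1
  refine hq.not_ge (le_of_forall_pow_le (C := C * q ^ L) (by positivity) fun n => ?_)
  calc (2 : ℝ) ^ n ≤ (ball (L * (n + 1))).card := by exact_mod_cast hcard n
    _ ≤ C * q ^ (L * (n + 1)) := hC _
    _ = _ := by rw [← pow_mul]; ring

/-! ### Branching -/

/-- The permutation that acts as `g` below the vertex `x` of the first level, and trivially
elsewhere. -/
def graft (x : Fin 3) : TreePerm →* TreePerm where
  toFun g := node 1 (Pi.mulSingle x g)
  map_one' := by rw [Pi.mulSingle_one, node_one]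
  map_mul' g h := by
    rw [node_mul, Pi.mulSingle_mul]
    rfl

theorem graft_apply (x : Fin 3) (g : TreePerm) : graft x g = node 1 (Pi.mulSingle x g) := rfl

theorem graft_cons_self (x : Fin 3) (g : TreePerm) (w : Vertex) :
    graft x g (x :: w) = x :: g w := by
  simp [graft_apply]

theorem graft_cons_of_ne {x y : Fin 3} (h : y ≠ x) (g : TreePerm) (w : Vertex) :
    graft x g (y :: w) = y :: w := by
  simp [graft_apply, h]

theorem graft_injective (x : Fin 3) : Function.Injective (graft x) := by
  intro g h hgh
  ext1 w
  have := congrArg (fun k : TreePerm => k (x :: w)) hgh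
  simpa [graft_cons_self] using this

theorem commute_graft {x y : Fin 3} (h : x ≠ y) (g k : TreePerm) :
    Commute (graft x g) (graft y k) := by
  rw [Commute, SemiconjBy, graft_apply, graft_apply, node_mul, node_mul]
  congr 1
  exact (Pi.mulSingle_commute (f := fun _ => TreePerm) h g k).eq

theorem node_mul_graft (σ : Equiv.Perm (Fin 3)) (r : Fin 3 → TreePerm) (x : Fin 3)
    (g : TreePerm) :
    node σ r * graft x g * (node σ r)⁻¹ = graft (σ x) (r x * g * (r x)⁻¹) := by
  rw [mul_inv_eq_iff_eq_mul, graft_apply, graft_apply, node_mul, node_mul]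
  congr 1
  ext1 y
  by_cases hy : y = x
  · subst hy; simp
  · simp [hy]

/-- The normal closure of the commutator `a * t * a⁻¹ * t⁻¹` in the group generated by `a` and `t`;
it is the derived subgroup of that group. -/
def derived : Subgroup TreePerm :=
  Subgroup.closure {x | ∃ g ∈ gens, g * (a * t * a⁻¹ * t⁻¹) * g⁻¹ = x}

theorem derived_le_gens : derived ≤ gens := by
  refine (Subgroup.closure_le _).2 ?_
  rintro _ ⟨g, hg, rfl⟩
  exact gens.mul_mem (gens.mul_mem hg
    (gens.mul_mem (gens.mul_mem (gens.mul_mem a_mem_gens t_mem_gens) (gens.inv_mem a_mem_gens))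
      (gens.inv_mem t_mem_gens))) (gens.inv_mem hg)

theorem conj_mem_derived {g k : TreePerm} (hg : g ∈ gens) (hk : k ∈ derived) :
    g * k * g⁻¹ ∈ derived := by
  induction hk using Subgroup.closure_induction with
  | mem x hx =>
    obtain ⟨k, hk, rfl⟩ := hx
    exact Subgroup.subset_closure ⟨g * k, gens.mul_mem hg hk, by group⟩
  | one => simp
  | mul x y _ _ hx hy => simpa [mul_assoc] using derived.mul_mem hx hy
  | inv x _ hx => simpa [mul_assoc] using derived.inv_mem hx

theorem commutator_mem_derived : a * t * a⁻¹ * t⁻¹ ∈ derived :=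
  Subgroup.subset_closure ⟨1, gens.one_mem, by simp⟩

theorem a_mul_t_pow_three_mem_derived : (a * t) ^ 3 ∈ derived := by
  have hκ := conj_mem_derived a_mem_gens commutator_mem_derived
  have h := derived.mul_mem commutator_mem_derived
    (conj_mem_derived t_mem_gens (derived.mul_mem hκ commutator_mem_derived))
  have ha : a⁻¹ * a⁻¹ = a := by
    rw [← mul_inv_rev, inv_eq_iff_mul_eq_one, ← pow_two, ← pow_succ, a_pow_three]
  have ht : t⁻¹ * t⁻¹ = t := by
    rw [← mul_inv_rev, inv_eq_iff_mul_eq_one, ← pow_two, ← pow_succ, t_pow_three]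
  have : (a * t) ^ 3 = a * t * (a * t) * ((a⁻¹ * a⁻¹) * (t⁻¹ * t⁻¹)) := by
    rw [ha, ht, pow_succ, pow_two]
  rw [this]
  convert h using 1
  group

/-- The conjugate of `t` whose section at the vertex `1` is `a`. -/
theorem conj_a_t_eq_node : a * t * a⁻¹ = node 1 ![t, a, 1] := by
  rw [mul_inv_eq_iff_eq_mul, a_eq_node]
  nth_rw 1 [t_eq_node]
  rw [node_mul, node_mul]
  congr 1
  ext1 x
  fin_cases x <;> simp [← a_eq_node]

/-- The conjugate of `t` whose section at the vertex `1` is `t`. -/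
theorem conj_a_conj_a_t_eq_node : a * (a * t * a⁻¹) * a⁻¹ = node 1 ![1, t, a] := by
  rw [conj_a_t_eq_node, mul_inv_eq_iff_eq_mul, a_eq_node, node_mul, node_mul]
  congr 1
  ext1 x
  fin_cases x <;> simp [← a_eq_node]

/-- Every element of the group is the section at the vertex `1` of an element that fixes the first
level. -/
theorem exists_node_mem_gens {g : TreePerm} (hg : g ∈ gens) :
    ∃ r : Fin 3 → TreePerm, node 1 r ∈ gens ∧ r 1 = g := by
  have h₀ : a * t * a⁻¹ ∈ gens :=
    gens.mul_mem (gens.mul_mem a_mem_gens t_mem_gens) (gens.inv_mem a_mem_gens)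
  induction hg using Subgroup.closure_induction with
  | mem x hx =>
    rcases hx with rfl | rfl
    · exact ⟨_, conj_a_t_eq_node ▸ h₀, rfl⟩
    · exact ⟨_, conj_a_conj_a_t_eq_node ▸
        gens.mul_mem (gens.mul_mem a_mem_gens h₀) (gens.inv_mem a_mem_gens), rfl⟩
  | one => exact ⟨1, by rw [node_one]; exact gens.one_mem, rfl⟩
  | mul x y _ _ hx hy =>
    obtain ⟨r, hr, rfl⟩ := hx
    obtain ⟨s, hs, rfl⟩ := hy
    exact ⟨r * s, by simpa [node_mul] using! gens.mul_mem hr hs, rfl⟩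
  | inv x _ hx =>
    obtain ⟨r, hr, rfl⟩ := hx
    refine ⟨r⁻¹, ?_, rfl⟩
    have : node 1 r⁻¹ * node 1 r = 1 := by
      rw [node_mul, ← node_one]
      congr 1
      ext1 x
      simp
    rw [eq_inv_of_mul_eq_one_left this]
    exact gens.inv_mem hr

/-- The group branches over `derived`: the commutator `a * t * a⁻¹ * t⁻¹`, placed below the
vertex `1`, is the commutator of the conjugates `⟨⟨t, a, 1⟩⟩` and `⟨⟨1, t, a⟩⟩` of `t`. -/
theorem graft_one_mem_derived {g : TreePerm} (hg : g ∈ derived) : graft 1 g ∈ derived := by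
  have hcomm : graft 1 (a * t * a⁻¹ * t⁻¹) ∈ derived := by
    have hκ := conj_mem_derived a_mem_gens commutator_mem_derived
    have h₀ : a * t * a⁻¹ ∈ gens :=
      gens.mul_mem (gens.mul_mem a_mem_gens t_mem_gens) (gens.inv_mem a_mem_gens)
    have h := derived.mul_mem (conj_mem_derived h₀ hκ) (derived.inv_mem hκ)
    convert h using 1
    have h1 : graft 1 (a * t * a⁻¹ * t⁻¹) =
        a * t * a⁻¹ * (a * (a * t * a⁻¹) * a⁻¹) * (a * t * a⁻¹)⁻¹ *
          (a * (a * t * a⁻¹) * a⁻¹)⁻¹ := by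
      rw [conj_a_conj_a_t_eq_node, conj_a_t_eq_node, eq_mul_inv_iff_mul_eq,
        eq_mul_inv_iff_mul_eq, graft_apply, node_mul, node_mul, node_mul]
      congr 1
      ext1 x
      fin_cases x <;> simp [← conj_a_t_eq_node]
    rw [h1]
    group
  induction hg using Subgroup.closure_induction with
  | mem x hx =>
    obtain ⟨g, hg, rfl⟩ := hx
    obtain ⟨r, hr, rfl⟩ := exists_node_mem_gens hg
    have := conj_mem_derived hr hcomm
    rwa [node_mul_graft] at this
  | one => rw [map_one]; exact derived.one_mem
  | mul x y _ _ hx hy => rw [map_mul]; exact derived.mul_mem hx hy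
  | inv x _ hx => rw [map_inv]; exact derived.inv_mem hx

/-! ### The element `a * t` -/

theorem a_mul_t_pow_three_eq_node : (a * t) ^ 3 = node 1 ![t * a, a * t, a * t] := by
  have h : a * t = node shift ![a, 1, t] := by
    nth_rw 1 [t_eq_node]
    rw [a_eq_node, node_mul]
    congr 1
  rw [pow_succ, pow_two]
  nth_rw 1 2 3 [h]
  rw [node_mul, node_mul]
  congr 1
  · decide
  · ext1 x
    fin_cases x <;> simp

theorem node_one_pow (r : Fin 3 → TreePerm) (n : ℕ) : node 1 r ^ n = node 1 (r ^ n) := by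
  induction n with
  | zero => simp [node_one]
  | succ n ih => rw [pow_succ, ih, node_mul, pow_succ]; rfl

theorem exists_a_mul_t_pow_eq_node (n : ℕ) : ∃ r, (a * t) ^ n = node (shift ^ n) r := by
  induction n with
  | zero => exact ⟨1, by simp [node_one]⟩
  | succ n ih =>
    obtain ⟨r, hr⟩ := ih
    rw [pow_succ, hr, a_eq_node, t_eq_node, node_mul, node_mul, pow_succ, mul_one]
    exact ⟨_, rfl⟩

theorem shift_pow_apply (n : ℕ) (x : Fin 3) : ((shift ^ n) x : ℕ) = (x + n) % 3 := by
  induction n with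
  | zero => simp [Nat.mod_eq_of_lt x.isLt]
  | succ n ih =>
    rw [pow_succ', Equiv.Perm.mul_apply, shift_apply, Fin.val_add, ih]
    simp [add_assoc]

theorem a_mul_t_pow_ne_one {n : ℕ} (hn : n ≠ 0) : (a * t) ^ n ≠ 1 := by
  induction n using Nat.strong_induction_on with
  | _ n ih =>
    intro h
    obtain ⟨r, hr⟩ := exists_a_mul_t_pow_eq_node n
    have h0 := congrArg (fun g : TreePerm => g [0]) (hr.symm.trans h)
    simp only [node_cons, Equiv.Perm.one_apply, List.cons.injEq] at h0
    have h1 := shift_pow_apply n 0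
    rw [h0.1] at h1
    obtain ⟨m, rfl⟩ : 3 ∣ n := Nat.dvd_of_mod_eq_zero (by simpa using h1.symm)
    refine ih m (by omega) (by omega) ?_
    rw [pow_mul, a_mul_t_pow_three_eq_node, node_one_pow] at h
    ext1 w
    have := congrArg (fun g : TreePerm => g (1 :: w)) h
    simpa using this

/-! ### Wreath products inside nilpotent groups -/

section Shifted

variable {Γ : Type*} [Group Γ]

/-- Conjugation by `u` permutes `h` and two other elements cyclically, the three elements commute,
and they are independent: `h` and `u` generate a group that acts on the conjugates of `h` as
`ℤ ≀ C₃` does on its base. Independence is stated for the exponent of `h` alone; conjugation by `u`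
gives it for the other two. -/
structure IsShifted (u h : Γ) : Prop where
  commute_one : Commute h (u * h * u⁻¹)
  commute_two : Commute h (u * (u * h * u⁻¹) * u⁻¹)
  period : u * (u * (u * h * u⁻¹) * u⁻¹) * u⁻¹ = h
  eq_zero : ∀ α β γ : ℤ, h ^ α * (u * h * u⁻¹) ^ β * (u * (u * h * u⁻¹) * u⁻¹) ^ γ = 1 → α = 0

/-- The element with exponents `v` with respect to `h` and its two conjugates. -/
def shiftedProd (u h : Γ) (v : ℤ × ℤ × ℤ) : Γ :=
  h ^ v.1 * (u * h * u⁻¹) ^ v.2.1 * (u * (u * h * u⁻¹) * u⁻¹) ^ v.2.2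

/-- The commutator `⁅c⁻¹, u⁆`. -/
def engel (u c : Γ) : Γ := c⁻¹ * (u * c * u⁻¹)

/-- The effect of `engel u` on exponents. -/
def cyclicDiff (v : ℤ × ℤ × ℤ) : ℤ × ℤ × ℤ := (v.2.2 - v.1, v.1 - v.2.1, v.2.1 - v.2.2)

/-- If `σ` is the cyclic shift, then `(σ - 1) ^ 2 * v = 0` gives `v = σ ^ 3 v = v + 3 (σ - 1) v`, so
that already `(σ - 1) v = 0`. -/
theorem cyclicDiff_iterate_ne_zero (n : ℕ) : cyclicDiff^[n + 1] (1, 0, 0) ≠ 0 := by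
  induction n with
  | zero => simp [cyclicDiff]
  | succ n ih =>
    rw [Function.iterate_succ_apply'] at ih ⊢
    rw [Function.iterate_succ_apply']
    generalize cyclicDiff^[n] (1, 0, 0) = v at ih ⊢
    intro h
    apply ih
    simp only [cyclicDiff, Prod.mk_eq_zero] at h ⊢
    omega

theorem map_engel_iterate {Γ' : Type*} [Group Γ'] (ψ : Γ →* Γ') (u c : Γ) (n : ℕ) :
    ψ ((engel u)^[n] c) = (engel (ψ u))^[n] (ψ c) := by
  induction n with
  | zero => rfl
  | succ n ih => rw [Function.iterate_succ_apply', Function.iterate_succ_apply', ← ih]; simp [engel]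

theorem exists_engel_iterate_eq_one [Group.IsNilpotent Γ] (u c : Γ) :
    ∃ n, (engel u)^[n] c = 1 := by
  obtain ⟨n, hn⟩ := Subgroup.nilpotent_iff_lowerCentralSeries.1 ‹Group.IsNilpotent Γ›
  have h : ∀ n, (engel u)^[n] c ∈ (⊤ : Subgroup Γ).lowerCentralSeries n := by
    intro n
    induction n with
    | zero => simp
    | succ n ih =>
      rw [Function.iterate_succ_apply']
      have := Subgroup.commutator_mem_commutator (inv_mem ih) (Subgroup.mem_top u)
      simpa [commutatorElement_def, engel, mul_assoc] using this
  exact ⟨n, by simpa [hn] using h n⟩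

namespace IsShifted

variable {u h : Γ}

theorem shiftedProd_mul (hs : IsShifted u h) (v w : ℤ × ℤ × ℤ) :
    shiftedProd u h v * shiftedProd u h w = shiftedProd u h (v + w) := by
  have h12 : Commute (u * h * u⁻¹) (u * (u * h * u⁻¹) * u⁻¹) := by
    simpa using hs.commute_one.map (MulAut.conj u)
  have h1 := hs.commute_one.symm.zpow_zpow v.2.1 w.1
  have h2 := (hs.commute_two.symm.zpow_zpow v.2.2 w.1).mul_right (h12.symm.zpow_zpow v.2.2 w.2.1)
  simp only [shiftedProd, Prod.fst_add, Prod.snd_add, zpow_add]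
  rw [h2.mul_mul_mul_comm, h1.mul_mul_mul_comm]

theorem shiftedProd_inv (hs : IsShifted u h) (v : ℤ × ℤ × ℤ) :
    (shiftedProd u h v)⁻¹ = shiftedProd u h (-v) := by
  rw [inv_eq_iff_mul_eq_one, hs.shiftedProd_mul]
  simp [shiftedProd]

theorem conj_shiftedProd (hs : IsShifted u h) (v : ℤ × ℤ × ℤ) :
    u * shiftedProd u h v * u⁻¹ = shiftedProd u h (v.2.2, v.1, v.2.1) := by
  have h1 := hs.commute_one.zpow_zpow v.2.2 v.1
  have h2 := hs.commute_two.zpow_zpow v.2.2 v.2.1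
  have h3 : u * shiftedProd u h v * u⁻¹ = (u * h * u⁻¹) ^ v.1 *
      (u * (u * h * u⁻¹) * u⁻¹) ^ v.2.1 * h ^ v.2.2 := by
    calc u * shiftedProd u h v * u⁻¹ = (u * h * u⁻¹) ^ v.1 * (u * (u * h * u⁻¹) * u⁻¹) ^ v.2.1 *
          (u * (u * (u * h * u⁻¹) * u⁻¹) * u⁻¹) ^ v.2.2 := by
          simp only [shiftedProd, conj_zpow]
          group
      _ = _ := by rw [hs.period]
  rw [h3, shiftedProd, mul_assoc (h ^ _)]
  exact (h1.mul_right h2).eq.symm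

theorem engel_shiftedProd (hs : IsShifted u h) (v : ℤ × ℤ × ℤ) :
    engel u (shiftedProd u h v) = shiftedProd u h (cyclicDiff v) := by
  rw [engel, hs.conj_shiftedProd, hs.shiftedProd_inv, hs.shiftedProd_mul]
  congr 1
  simp only [cyclicDiff, Prod.ext_iff, Prod.fst_add, Prod.snd_add, Prod.fst_neg, Prod.snd_neg]
  omega

theorem eq_zero_of_shiftedProd_eq_one (hs : IsShifted u h) {v : ℤ × ℤ × ℤ}
    (hv : shiftedProd u h v = 1) : v = 0 := by
  have h1 := hs.conj_shiftedProd v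
  rw [hv, mul_one, mul_inv_cancel] at h1
  have h2 := hs.conj_shiftedProd (v.2.2, v.1, v.2.1)
  rw [← h1, mul_one, mul_inv_cancel] at h2
  exact Prod.ext (hs.eq_zero _ _ _ hv)
    (Prod.ext (hs.eq_zero _ _ _ h2.symm) (hs.eq_zero _ _ _ h1.symm))

theorem not_isNilpotent (hs : IsShifted u h) {H : Type*} [Group H] (ψ : H →* Γ) {u' x : H}
    (hu : ψ u' = u) (hx : ψ x = engel u h) : ¬ Group.IsNilpotent H := by
  intro hH
  obtain ⟨n, hn⟩ := exists_engel_iterate_eq_one u' x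
  have hiter : ∀ n, (engel u)^[n] h = shiftedProd u h (cyclicDiff^[n] (1, 0, 0)) := by
    intro n
    induction n with
    | zero => simp [shiftedProd]
    | succ n ih =>
      rw [Function.iterate_succ_apply', ih, hs.engel_shiftedProd, Function.iterate_succ_apply']
  have h1 := map_engel_iterate ψ u' x n
  rw [hn, map_one, hu, hx, ← Function.iterate_succ_apply, hiter] at h1
  exact cyclicDiff_iterate_ne_zero n (hs.eq_zero_of_shiftedProd_eq_one h1.symm)

theorem map (hs : IsShifted u h) {Γ' : Type*} [Group Γ'] {ψ : Γ →* Γ'}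
    (hψ : Function.Injective ψ) {u' : Γ'} (hu : ∀ g, u' * ψ g * u'⁻¹ = ψ (u * g * u⁻¹)) :
    IsShifted u' (ψ h) where
  commute_one := by rw [hu]; exact hs.commute_one.map ψ
  commute_two := by rw [hu, hu]; exact hs.commute_two.map ψ
  period := by rw [hu, hu, hu, hs.period]
  eq_zero α β γ hv := by
    rw [hu, hu, ← map_zpow, ← map_zpow, ← map_zpow, ← map_mul, ← map_mul] at hv
    exact hs.eq_zero α β γ (hψ (hv.trans (map_one ψ).symm))

end IsShifted

end Shifted

theorem node_one_mul_graft (r : Fin 3 → TreePerm) (x : Fin 3) (g : TreePerm) :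
    node 1 r * graft x g * (node 1 r)⁻¹ = graft x (r x * g * (r x)⁻¹) :=
  node_mul_graft 1 r x g

theorem a_mul_t_pow_mul_graft (k : ℕ) (g : TreePerm) :
    (a * t) ^ (3 * k) * graft 1 g * ((a * t) ^ (3 * k))⁻¹ =
      graft 1 ((a * t) ^ k * g * ((a * t) ^ k)⁻¹) := by
  rw [pow_mul, a_mul_t_pow_three_eq_node, node_one_pow, node_one_mul_graft]
  rfl

/-- If `3` does not divide `k`, then `(a * t) ^ k` moves the vertex `1`. Its cube has the section
`(a * t) ^ k` there, which commutes with `(a * t) ^ 3`. -/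
theorem isShifted_of_not_dvd {k : ℕ} (hk : ¬ 3 ∣ k) :
    IsShifted ((a * t) ^ k) (graft 1 ((a * t) ^ 3)) := by
  obtain ⟨r, hr⟩ := exists_a_mul_t_pow_eq_node k
  have hperiod := a_mul_t_pow_mul_graft k ((a * t) ^ 3)
  rw [(Commute.pow_pow_self (a * t) k 3).eq, mul_inv_cancel_right, mul_comm 3 k, pow_mul] at hperiod
  have hx : (shift ^ k) 1 ≠ 1 := fun h => by
    have := shift_pow_apply k 1
    rw [h] at this
    simp at this
    omega
  have hy : (shift ^ k) ((shift ^ k) 1) ≠ 1 := fun h => by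
    have := shift_pow_apply k ((shift ^ k) 1)
    rw [h, shift_pow_apply k 1] at this
    simp at this
    omega
  refine ⟨?_, ?_, ?_, fun α β γ h => ?_⟩
  · rw [hr, node_mul_graft]
    exact commute_graft hx.symm _ _
  · rw [hr, node_mul_graft, node_mul_graft]
    exact commute_graft hy.symm _ _
  · refine Eq.trans ?_ hperiod
    generalize (a * t) ^ k = u
    simp only [pow_succ u, pow_zero, one_mul, mul_inv_rev, mul_assoc]
  · rw [hr, node_mul_graft, node_mul_graft, ← map_zpow, ← map_zpow, ← map_zpow] at h
    -- below the vertex `1` only the first of the three factors acts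
    have h1 : ((a * t) ^ 3) ^ α = 1 := by
      ext1 w
      have := congrArg (fun g : TreePerm => g (1 :: w)) h
      simpa only [Equiv.Perm.mul_apply, graft_cons_of_ne hx.symm, graft_cons_of_ne hy.symm,
        graft_cons_self, Equiv.Perm.one_apply, List.cons.injEq, true_and] using this
    by_contra hα
    refine a_mul_t_pow_ne_one (n := 3 * α.natAbs) (by omega) ?_
    rw [pow_mul]
    rcases Int.natAbs_eq α with h2 | h2 <;> rw [h2] at h1
    · simpa using h1
    · simpa using h1

/-- Write `k = 3 ^ m * l` with `l` prime to `3`. Below the vertex `1 ⋯ 1` of level `m` the power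
`(a * t) ^ k` acts as `(a * t) ^ l`. -/
theorem exists_isShifted {k : ℕ} (hk : k ≠ 0) : ∃ h ∈ gens, IsShifted ((a * t) ^ k) h := by
  obtain ⟨m, l, hl, rfl⟩ := Nat.exists_eq_pow_mul_and_not_dvd hk 3 (by norm_num)
  suffices ∃ h ∈ derived, IsShifted ((a * t) ^ (3 ^ m * l)) h from
    this.imp fun h hh => ⟨derived_le_gens hh.1, hh.2⟩
  clear hk
  induction m with
  | zero =>
    exact ⟨_, graft_one_mem_derived a_mul_t_pow_three_mem_derived, by
      simpa using isShifted_of_not_dvd hl⟩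
  | succ m ih =>
    obtain ⟨h, hh, hs⟩ := ih
    refine ⟨graft 1 h, graft_one_mem_derived hh, hs.map (graft_injective 1) fun g => ?_⟩
    rw [pow_succ' 3, mul_assoc 3, a_mul_t_pow_mul_graft]

theorem not_isPeriodicExtensionOfLocallyNilpotent :
    ¬ IsPeriodicExtensionOfLocallyNilpotent fabrykowskiGuptaGroup := by
  rintro ⟨N, P, _, _, S, hN, hP⟩
  have hlift : ∀ g ∈ gens, ∃ x, toTreePerm x = g := fun g hg => by
    rwa [← range_toTreePerm] at hg
  obtain ⟨s, hs⟩ := hlift _ (gens.mul_mem a_mem_gens t_mem_gens)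
  obtain ⟨k, hk, hsk⟩ := isOfFinOrder_iff_pow_eq_one.1 (hP (S.rightHom s))
  obtain ⟨h, hh, hshift⟩ := exists_isShifted hk.ne'
  obtain ⟨h, rfl⟩ := hlift h hh
  have hker : ∀ g, S.rightHom g = 1 → ∃ n, S.inl n = g := fun g hg => by
    have : g ∈ S.inl.range := by rw [S.range_inl_eq_ker_rightHom]; exact hg
    exact this
  obtain ⟨u, hu⟩ := hker (s ^ k) (by rw [map_pow, hsk])
  obtain ⟨x, hx⟩ := hker (engel (s ^ k) h) (by rw [engel]; simp [hsk])
  have hnil := hN (Subgroup.closure {u, x}) ((Subgroup.fg_iff _).2 ⟨{u, x}, rfl, by simp⟩)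
  refine hshift.not_isNilpotent
    ((toTreePerm.comp S.inl).comp (Subgroup.closure {u, x}).subtype)
    (u' := ⟨u, Subgroup.subset_closure (by simp)⟩)
    (x := ⟨x, Subgroup.subset_closure (by simp)⟩) ?_ ?_ hnil
  · simp [hu, hs]
  · simp [hx, hs, engel]

theorem exists_closure_pair_eq_top :
    ∃ x y : fabrykowskiGuptaGroup, Subgroup.closure {x, y} = ⊤ := by
  refine ⟨⟨_, Subgroup.subset_closure (Set.mem_insert _ _)⟩,
    ⟨_, Subgroup.subset_closure (Set.mem_insert_of_mem _ (Set.mem_singleton _))⟩, ?_⟩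
  apply Subgroup.map_injective (Subgroup.subtype_injective fabrykowskiGuptaGroup)
  rw [MonoidHom.map_closure, Set.image_pair, ← MonoidHom.range_eq_map, Subgroup.range_subtype]
  rfl

end FabrykowskiGupta

theorem mainTheorem2 :
    (∃ x y : fabrykowskiGuptaGroup, Subgroup.closure {x, y} = ⊤) ∧
    ¬ HasFreeSubsemigroup fabrykowskiGuptaGroup ∧
    ¬ IsPeriodicExtensionOfLocallyNilpotent fabrykowskiGuptaGroup ∧
    ¬ (∀ (G : Type) [Group G], Group.FG G → ¬ HasFreeSubsemigroup G →
        IsPeriodicExtensionOfLocallyNilpotent G) := by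
  have hgen := FabrykowskiGupta.exists_closure_pair_eq_top
  have hfree := FabrykowskiGupta.not_hasFreeSubsemigroup
  have hext := FabrykowskiGupta.not_isPeriodicExtensionOfLocallyNilpotent
  refine ⟨hgen, hfree, hext, fun h => hext (h _ ?_ hfree)⟩
  classical
  obtain ⟨x, y, hxy⟩ := hgen
  exact ⟨⟨{x, y}, by simpa using hxy⟩⟩
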